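/- For $k,e\ge 0$ let $c_e^k$ be the number of finite sets $\lambda\subset\mathbb N^k$ that are closed downwards for the componentwise order, have $1+k+e$ elements, contain exactly $k$ points of degree $1$ (the degree of a point being the sum of its coordinates), and all of whose maximal elements have degree at least $2$. For $x\in\mathbb Z_{\ge 0}$ set $$\mathsf C_x(t)=\begin{cases}\displaystyle\sum_{e\ge\lceil x/2\rceil}c_{e+1}^{2(e+1)-x}\,t^{e-\lceil x/2\rceil}& x\text{ even},\\[2mm] \displaystyle\sum_{e\ge\lceil x/2\rceil}c_{e}^{2e-x}\,t^{e-\lceil x/2\rceil}& x\text{ odd},\end{cases}$$ in $\mathbb Z[[t]]$, and let $\mathrm{Bor}\bigl(\sum_{k}f_kt^k\bigr)=\sum_k\frac{f_k}{k!}t^k$ on $\mathbb Q[[t]]$. Theorem. For every $x\in\mathbb Z_{\ge 0}$ there is a polynomial $\mathsf c_x(t)=\sum_{h=0}^{2x-\lceil x/2\rceil}\mu_h^{(x)}t^h\in\mathbb Q[t]$, of degree at most $2x-\lceil x/2\rceil$, such that $$\mathrm{Bor}(\mathsf C_x(t))=\frac{\mathsf c_x(t)}{(1-2t)^{\frac32+2x-\lceil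 x/2\rceil}}$$ in $\mathbb Q[[t]]$, where the negative power of $1-2t$ is its binomial series. In particular $\mathrm{Bor}(\mathsf C_x(t))$ is analytic at $t=0$: it is the Taylor expansion at the origin of the function on the right-hand side. Moreover $\mathsf c_0(t)=1$, and for $\alpha\ge 1$: (1) if $x=2\alpha$, then for $0\le h\le 3\alpha$ $$\mu_h^{(2\alpha)}=\sum_{z=0}^{h}\frac{(-1)^{z+h}2^h\,c_{z+1+\alpha}^{2z+2}}{(2z+1)!!}\sum_{y=z}^{3\alpha-1}\binom{3\alpha-y}{h-y}\binom{y+1}{z+1}\frac{(2y+1)!!}{(2y+2)!!}\left(\frac{(2y+3)(3\alpha-h)}{3\alpha-y}-1\right),$$ where $\binom{3\alpha-y}{h-y}=0$ if $y>h$; (2) if $x=2\alpha-1$, then for $0\le h\le 3\alpha-2$ $$\mu_h^{(2\alpha-1)}=\sum_{z=0}^{h}\frac{(-1)^{z}\,c_{z+\alpha}^{2z+1}}{(2z+1)!!\,z!}\sum_{y=z}^{h}\binom{3\alpha-2-y}{h-y}\frac{(-1)^{h}(2y+1)!!\,2^{h-y}}{(y-z)!}.$$ -/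

import Mathlib

namespace HigherPartition

open scoped Nat

/-- The degree `y₁ + ⋯ + yₙ` of a lattice point. -/
def deg {n : ℕ} (y : Fin n → ℕ) : ℕ := ∑ i, y i

/-- `(n-1)`-dimensional partitions of size `d`: subsets of `ℕⁿ` with `d` elements that are closed
downwards for the componentwise order. -/
def P (n d : ℕ) : Set (Finset (Fin n → ℕ)) :=
  {l | IsLowerSet (l : Set (Fin n → ℕ)) ∧ l.card = d}

/-- The Hilbert–Samuel function `i ↦ |λ_{=i}|`; its value at `1` is the embedding dimension. -/
def hilbertSamuel {n : ℕ} (l : Finset (Fin n → ℕ)) (i : ℕ) : ℕ :=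
  (l.filter fun y => deg y = i).card

/-- The part `λ_{≥k}` of a partition. -/
def degGE {n : ℕ} (l : Finset (Fin n → ℕ)) (k : ℕ) : Finset (Fin n → ℕ) :=
  l.filter fun y => k ≤ deg y

open Classical in
/-- The socle: the maximal elements of `λ`. -/
noncomputable def socle {n : ℕ} (l : Finset (Fin n → ℕ)) : Finset (Fin n → ℕ) :=
  l.filter fun y => ∀ a ∈ l, ¬ y < a

/-- Partitions of size `d` in `ℕᵏ` with embedding dimension `k`. -/
def Y (k d : ℕ) : Set (Finset (Fin k → ℕ)) :=
  {l | l ∈ P k d ∧ hilbertSamuel l 1 = k}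

/-- Partitions of size `1 + k + e` in `ℕᵏ` with embedding dimension `k` whose socle lies in
degrees at least `2`. -/
def C (k e : ℕ) : Set (Finset (Fin k → ℕ)) :=
  {l | l ∈ Y k (1 + k + e) ∧ socle l ⊆ degGE l 2}

/-- There are finitely many partitions of a given size, so that the cardinality `c` below is not
a default value. -/
theorem finite_P (n d : ℕ) : (P n d).Finite := by
  classical
  refine Set.Finite.subset
    (Finset.finite_toSet (Fintype.piFinset fun _ : Fin n => Finset.range d).powerset) ?_
  rintro l ⟨hl, hd⟩
  simp only [Finset.coe_powerset, Set.mem_preimage, Set.mem_powerset_iff, Finset.coe_subset]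
  intro y hy
  rw [Fintype.mem_piFinset]
  intro i
  rw [Finset.mem_range, ← hd]
  have h : (Finset.range (y i + 1)).image (fun j => Function.update y i j) ⊆ l := by
    intro z hz
    obtain ⟨j, hj, rfl⟩ := Finset.mem_image.1 hz
    refine hl ?_ hy
    intro m
    by_cases hm : m = i
    · subst hm
      simpa using Nat.lt_succ_iff.1 (Finset.mem_range.1 hj)
    · simp [hm]
  have h2 := Finset.card_le_card h
  rw [Finset.card_image_of_injective _ (Function.update_injective y i), Finset.card_range] at h2
  omega

/-- The number `c_e^k`. -/
noncomputable def c (e k : ℕ) : ℕ := (C k e).ncard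

/-- The exponent `2x - ⌈x/2⌉` (the subtraction never truncates). -/
def degBound (x : ℕ) : ℕ := 2 * x - x ⌈/⌉ 2

/-- The series `C_x(t)`. The summation index `e ≥ ⌈x/2⌉` is written `e = n + ⌈x/2⌉`, so both
superscripts `2(e+1)-x` and `2e-x` are honest natural numbers. -/
noncomputable def genC (x : ℕ) : PowerSeries ℤ :=
  PowerSeries.mk fun n =>
    if Even x then (c (n + x ⌈/⌉ 2 + 1) (2 * (n + x ⌈/⌉ 2 + 1) - x) : ℤ)
    else (c (n + x ⌈/⌉ 2) (2 * (n + x ⌈/⌉ 2) - x) : ℤ)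

/-- The Borel transform on `ℚ⟦t⟧`. -/
noncomputable def borel (f : PowerSeries ℚ) : PowerSeries ℚ :=
  PowerSeries.mk fun n => PowerSeries.coeff n f / (n ! : ℚ)

/-- The Borel transform of `C_x(t)`, viewed in `ℚ⟦t⟧`. -/
noncomputable def borelC (x : ℕ) : PowerSeries ℚ :=
  borel (PowerSeries.map (Int.castRingHom ℚ) (genC x))

/-- The binomial series of `(1 - 2t)^r` for a rational exponent `r`. -/
noncomputable def oneSubTwoPow (r : ℚ) : PowerSeries ℚ :=
  PowerSeries.rescale (-2 : ℚ) (PowerSeries.binomialSeries ℚ r)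

/-- The coefficient `μ_h^{(2α)}`, for `α ≥ 1`. The binomial coefficient `binom(3α-y, h-y)` is zero
when `y > h`. -/
noncomputable def muEven (α h : ℕ) : ℚ :=
  ∑ z ∈ Finset.Icc 0 h,
    (-1) ^ (z + h) * 2 ^ h * (c (z + 1 + α) (2 * z + 2) : ℚ) / ((2 * z + 1)‼ : ℚ) *
      ∑ y ∈ Finset.Icc z (3 * α - 1),
        (if y ≤ h then ((3 * α - y).choose (h - y) : ℚ) else 0) * ((y + 1).choose (z + 1) : ℚ) *
          (((2 * y + 1)‼ : ℚ) / ((2 * y + 2)‼ : ℚ)) *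
          ((2 * (y : ℚ) + 3) * (3 * (α : ℚ) - h) / (3 * (α : ℚ) - y) - 1)

/-- The coefficient `μ_h^{(2α-1)}`, for `α ≥ 1` and `h ≤ 3α - 2`. -/
noncomputable def muOdd (α h : ℕ) : ℚ :=
  ∑ z ∈ Finset.Icc 0 h,
    (-1) ^ z * (c (z + α) (2 * z + 1) : ℚ) / (((2 * z + 1)‼ : ℚ) * (z ! : ℚ)) *
      ∑ y ∈ Finset.Icc z h,
        ((3 * α - 2 - y).choose (h - y) : ℚ) *
          ((-1) ^ h * ((2 * y + 1)‼ : ℚ) * 2 ^ (h - y) / ((y - z)! : ℚ))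

end HigherPartition

/-! Read the variables as vertices and the degree two points as edges of a graph, loops allowed. For
`k ≥ 1` the socle condition says that every vertex lies on an edge. Call an edge isolated if no
other point of degree at least two involves its endpoints. Deleting one removes three points and two
variables, so `(k, e)` becomes `(k - 2, e - 1)` and `x = 2e - k` is preserved. Choosing `m` disjoint
pairs among `k + 2m` variables gives `(k+2m)! / (2^m m! k!)` (`cIso_add`), so all counts with fixed
`x` are determined by those without isolated edges (`card_thick`).

Without isolated edges a discharging argument gives `2k ≤ 3e` (`IsThick.two_mul_le`). With `x` fixed
this leaves finitely many `k`, hence finitely many unknowns `a_j` (`aOdd`, `aEven`). The count for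
index `n` is then `(2n+1)‼ n!` (`x` odd) or `(2n+1)‼ (n+1)!` (`x = 2α > 0`) times `∑ a_j / (n-j)!`.

The Borel transform divides by `n!`, and `(2n+1)‼ / (n-j)!` is the coefficient of `t^n` in `(2j+1)‼
t^j (1-2t)^(-3/2-j)` (`coeff_basisPoly_mul`). A common denominator gives the polynomial numerator.
Inverting the exponential convolution (`binomial_inversion`) expresses the `a_j` through the counts
and yields the `μ_h`. For `x = 0` only perfect matchings survive (`c_matching`). -/

namespace HigherPartition

open Finset
open scoped Nat

/-! ### Degree two points as edges of a graph -/

/-- The degree two point `eᵢ + eⱼ`. -/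
def edge {n : ℕ} (i j : Fin n) : Fin n → ℕ := Pi.single i 1 + Pi.single j 1

theorem edge_comm {n : ℕ} (i j : Fin n) : edge i j = edge j i := add_comm _ _

theorem edge_left_ne_zero {n : ℕ} (i j : Fin n) : edge i j i ≠ 0 := by simp [edge]

theorem edge_right_ne_zero {n : ℕ} (i j : Fin n) : edge i j j ≠ 0 := by simp [edge]

theorem edge_apply_ne_zero {n : ℕ} {i j a : Fin n} : edge i j a ≠ 0 ↔ a = i ∨ a = j := by
  simp only [edge, Pi.add_apply, Pi.single_apply]
  split_ifs <;> simp_all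

theorem deg_single {n : ℕ} (i : Fin n) : deg (Pi.single i 1 : Fin n → ℕ) = 1 := by
  simp [deg]

theorem deg_edge {n : ℕ} (i j : Fin n) : deg (edge i j) = 2 := by
  simp [deg, edge, Finset.sum_add_distrib]

theorem single_le_edge {n : ℕ} (i j : Fin n) : (Pi.single i 1 : Fin n → ℕ) ≤ edge i j := by
  intro a; simp [edge]

theorem single_le_iff {n : ℕ} {i : Fin n} {y : Fin n → ℕ} :
    (Pi.single i 1 : Fin n → ℕ) ≤ y ↔ y i ≠ 0 := by
  rw [Pi.le_def]
  constructor
  · intro h; have := h i; simp at this; omega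
  · intro h a
    by_cases ha : a = i
    · subst ha; simp; omega
    · simp [ha]

theorem exists_edge_le {n : ℕ} {y : Fin n → ℕ} {i : Fin n} (hi : y i ≠ 0) (hy : 2 ≤ deg y) :
    ∃ j, edge i j ≤ y := by
  by_cases h2 : 2 ≤ y i
  · refine ⟨i, fun a => ?_⟩
    by_cases ha : a = i
    · subst ha; simpa [edge] using h2
    · simp [edge, ha]
  · have h1 : y i = 1 := by omega
    obtain ⟨j, hji, hj⟩ : ∃ j, j ≠ i ∧ y j ≠ 0 := by
      by_contra! hcon
      have : deg y = y i := by
        unfold deg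
        exact Finset.sum_eq_single i (fun b _ hb => hcon b hb) (by simp)
      omega
    refine ⟨j, fun a => ?_⟩
    by_cases ha : a = i
    · subst ha; simp [edge, h1, hji.symm]
    · by_cases haj : a = j
      · subst haj; simp [edge, ha]; omega
      · simp [edge, ha, haj]

theorem eq_of_le_edge {n : ℕ} {i j : Fin n} (hij : i ≠ j) {y : Fin n → ℕ} (hy : y ≤ edge i j) :
    y = 0 ∨ y = Pi.single i 1 ∨ y = Pi.single j 1 ∨ y = edge i j := by
  have hi : y i ≤ 1 := by simpa [edge, hij] using hy i
  have hj : y j ≤ 1 := by simpa [edge, hij.symm] using hy j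
  have h0 : ∀ a, a ≠ i → a ≠ j → y a = 0 := fun a hai haj => by
    simpa [edge, hai, haj] using hy a
  have key : y = fun a => if a = i then y i else if a = j then y j else 0 := by
    funext a
    split_ifs with h1 h2
    · rw [h1]
    · rw [h2]
    · exact h0 a h1 h2
  rw [key]
  generalize y i = p at *
  generalize y j = q at *
  clear key h0 hy
  have hp : p = 0 ∨ p = 1 := by omega
  have hq : q = 0 ∨ q = 1 := by omega
  rcases hp with rfl | rfl <;> rcases hq with rfl | rfl
  · left; funext a; simp
  · right; right; left; funext a; by_cases ha : a = i
    · subst ha; simp [hij]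
    · simp [ha, Pi.single_apply]
  · right; left; funext a; simp [Pi.single_apply]
  · right; right; right; funext a; by_cases ha : a = i
    · subst ha; simp [edge, hij]
    · simp [ha, edge, Pi.single_apply]

/-! ### The socle condition in terms of edges -/

/-- Partitions of size `1 + k + e` in `ℕᵏ` in which every `eᵢ` lies below a point of degree `2`. -/
def IsThick {k : ℕ} (e : ℕ) (l : Finset (Fin k → ℕ)) : Prop :=
  IsLowerSet (l : Set (Fin k → ℕ)) ∧ l.card = 1 + k + e ∧ 0 ∈ l ∧ ∀ i, ∃ j, edge i j ∈ l

theorem IsThick.single_mem {k e : ℕ} {l : Finset (Fin k → ℕ)} (h : IsThick e l) (i : Fin k) :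
    Pi.single i 1 ∈ l := by
  obtain ⟨j, hj⟩ := h.2.2.2 i
  exact h.1 (single_le_edge i j) hj

theorem finite_thick (k e : ℕ) : {l : Finset (Fin k → ℕ) | IsThick e l}.Finite :=
  (finite_P k (1 + k + e)).subset fun _ h => ⟨h.1, h.2.1⟩

/-- The finite set of all `l` with `IsThick e l`. -/
noncomputable def thick (k e : ℕ) : Finset (Finset (Fin k → ℕ)) := (finite_thick k e).toFinset

theorem mem_thick {k e : ℕ} {l : Finset (Fin k → ℕ)} : l ∈ thick k e ↔ IsThick e l := by
  simp [thick]

theorem deg_eq_one_iff {n : ℕ} {y : Fin n → ℕ} : deg y = 1 ↔ ∃ i, y = Pi.single i 1 := by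
  constructor
  · intro h
    obtain ⟨i, hi⟩ : ∃ i, y i ≠ 0 := by
      by_contra! hcon
      simp [deg, hcon] at h
    refine ⟨i, ?_⟩
    have hle : ∀ a, (Pi.single i 1 : Fin n → ℕ) a ≤ y a := single_le_iff.2 hi
    have hs : ∑ a, (Pi.single i 1 : Fin n → ℕ) a = ∑ a, y a := by
      rw [show ∑ a, y a = 1 from h]; simp
    have := (Finset.sum_eq_sum_iff_of_le fun a _ => hle a).1 hs
    funext a
    exact (this a (mem_univ a)).symm
  · rintro ⟨i, rfl⟩; exact deg_single i

theorem deg_eq_zero_iff {n : ℕ} {y : Fin n → ℕ} : deg y = 0 ↔ y = 0 := by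
  simp [deg, funext_iff]

theorem filter_deg_one_subset {n : ℕ} (l : Finset (Fin n → ℕ)) :
    (l.filter fun y => deg y = 1) ⊆ univ.image fun i : Fin n => (Pi.single i 1 : Fin n → ℕ) := by
  intro y hy
  obtain ⟨i, rfl⟩ := deg_eq_one_iff.1 (mem_filter.1 hy).2
  exact mem_image_of_mem _ (mem_univ i)

theorem single_one_injective {n : ℕ} :
    Function.Injective fun i : Fin n => (Pi.single i 1 : Fin n → ℕ) := by
  intro a b h
  have := congrFun h a
  by_contra hab
  simp [hab] at this

theorem hilbertSamuel_one_eq_iff {n : ℕ} {l : Finset (Fin n → ℕ)} :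
    hilbertSamuel l 1 = n ↔ ∀ i, Pi.single i 1 ∈ l := by
  have hc : (univ.image fun i : Fin n => (Pi.single i 1 : Fin n → ℕ)).card = n := by
    rw [card_image_of_injective _ single_one_injective, card_univ, Fintype.card_fin]
  constructor
  · intro h i
    have := Finset.eq_of_subset_of_card_le (filter_deg_one_subset l) (by
      rw [hc]; exact h.ge)
    have hi : (Pi.single i 1 : Fin n → ℕ) ∈ l.filter fun y => deg y = 1 := by
      rw [this]; exact mem_image_of_mem _ (mem_univ i)
    exact (mem_filter.1 hi).1
  · intro h
    have : (l.filter fun y => deg y = 1) = univ.image fun i : Fin n => (Pi.single i 1 : Fin n → ℕ) := by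
      refine (filter_deg_one_subset l).antisymm ?_
      intro y hy
      obtain ⟨i, -, rfl⟩ := mem_image.1 hy
      exact mem_filter.2 ⟨h i, deg_single i⟩
    rw [hilbertSamuel, this, hc]

theorem deg_lt_deg {n : ℕ} {y z : Fin n → ℕ} (h : y < z) : deg y < deg z := by
  obtain ⟨hle, i, hi⟩ := Pi.lt_def.1 h
  exact Finset.sum_lt_sum (fun a _ => hle a) ⟨i, mem_univ i, hi⟩

theorem mem_socle {n : ℕ} {l : Finset (Fin n → ℕ)} {y : Fin n → ℕ} :
    y ∈ socle l ↔ y ∈ l ∧ ∀ a ∈ l, ¬ y < a := by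
  simp [socle]

/-- A non-maximal `eᵢ` lies below a point of degree at least two, hence below some `eᵢ + eⱼ`. At
least one variable is needed: in `ℕ⁰` the partition `{0}` is thick, but its socle has degree `0`. -/
theorem mem_C_iff_isThick {k e : ℕ} {l : Finset (Fin (k + 1) → ℕ)} :
    l ∈ C (k + 1) e ↔ IsThick e l := by
  constructor
  · rintro ⟨⟨⟨hl, hc⟩, hs⟩, hsoc⟩
    rw [hilbertSamuel_one_eq_iff] at hs
    refine ⟨hl, hc, hl (fun a => Nat.zero_le _) (hs 0), fun i => ?_⟩
    have hi : (Pi.single i 1 : Fin (k + 1) → ℕ) ∉ socle l := by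
      intro h
      have := (mem_filter.1 (hsoc h)).2
      rw [deg_single] at this
      omega
    have : ∃ a ∈ l, (Pi.single i 1 : Fin (k + 1) → ℕ) < a := by
      by_contra! hcon
      exact hi (mem_socle.2 ⟨hs i, hcon⟩)
    obtain ⟨a, ha, hlt⟩ := this
    have hd := deg_lt_deg hlt
    rw [deg_single] at hd
    obtain ⟨j, hj⟩ := exists_edge_le (single_le_iff.1 hlt.le) hd
    exact ⟨j, hl hj ha⟩
  · intro h
    refine ⟨⟨⟨h.1, h.2.1⟩, hilbertSamuel_one_eq_iff.2 h.single_mem⟩, fun y hy => ?_⟩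
    obtain ⟨hyl, hmax⟩ := mem_socle.1 hy
    refine mem_filter.2 ⟨hyl, ?_⟩
    by_contra hlt
    have hd : deg y = 0 ∨ deg y = 1 := by omega
    rcases hd with hd | hd
    · rw [deg_eq_zero_iff] at hd
      subst hd
      refine hmax _ (h.single_mem 0) (lt_of_le_of_ne (fun a => Nat.zero_le _) fun h0 => ?_)
      simpa using congrFun h0 0
    · obtain ⟨i, rfl⟩ := deg_eq_one_iff.1 hd
      obtain ⟨j, hj⟩ := h.2.2.2 i
      refine hmax _ hj (lt_of_le_of_ne (single_le_edge i j) fun h0 => ?_)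
      have := congrArg deg h0
      rw [deg_single, deg_edge] at this
      omega

theorem c_succ_eq_card_thick (e k : ℕ) : c e (k + 1) = (thick (k + 1) e).card := by
  rw [c, ← Set.ncard_coe_finset]
  congr 1
  ext l
  rw [mem_C_iff_isThick, mem_coe, mem_thick]

/-! ### Isolated edges: adjoining and deleting -/

/-- `{i, j}` is a connected component of `l` consisting of the single edge `eᵢ + eⱼ`. -/
def IsolatedPair {n : ℕ} (l : Finset (Fin n → ℕ)) (i j : Fin n) : Prop :=
  edge i j ∈ l ∧
    ∀ y ∈ l, y i ≠ 0 ∨ y j ≠ 0 → y = Pi.single i 1 ∨ y = Pi.single j 1 ∨ y = edge i j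

open Classical in
/-- The isolated edges of `l`, recorded by their endpoints `i < j`. -/
noncomputable def isolatedPairs {n : ℕ} (l : Finset (Fin n → ℕ)) : Finset (Fin n × Fin n) :=
  univ.filter fun p => p.1 < p.2 ∧ IsolatedPair l p.1 p.2

theorem mem_isolatedPairs {n : ℕ} {l : Finset (Fin n → ℕ)} {p : Fin n × Fin n} :
    p ∈ isolatedPairs l ↔ p.1 < p.2 ∧ IsolatedPair l p.1 p.2 := by
  simp [isolatedPairs]

/-- The order embedding of `Fin k` whose image misses exactly `i` and `j`. -/
noncomputable def skipPair {k : ℕ} {i j : Fin (k + 2)} (hij : i ≠ j) : Fin k ↪o Fin (k + 2) :=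
  ({i, j}ᶜ : Finset (Fin (k + 2))).orderEmbOfFin (by
    rw [card_compl, card_pair hij, Fintype.card_fin]; omega)

section skip

variable {k : ℕ} {i j : Fin (k + 2)} (hij : i ≠ j)

theorem range_skipPair (a : Fin (k + 2)) : (∃ b, skipPair hij b = a) ↔ a ≠ i ∧ a ≠ j := by
  have := Finset.range_orderEmbOfFin ({i, j}ᶜ : Finset (Fin (k + 2))) (k := k) (by
    rw [card_compl, card_pair hij, Fintype.card_fin]; omega)
  have h2 := Set.ext_iff.1 this a
  rw [Set.mem_range, mem_coe, mem_compl, mem_insert, mem_singleton, not_or] at h2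
  exact h2

theorem skipPair_ne_left (a : Fin k) : skipPair hij a ≠ i :=
  ((range_skipPair hij _).1 ⟨a, rfl⟩).1

theorem skipPair_ne_right (a : Fin k) : skipPair hij a ≠ j :=
  ((range_skipPair hij _).1 ⟨a, rfl⟩).2

/-- Extension by zero in the coordinates `i` and `j`. -/
noncomputable def extendPair (y : Fin k → ℕ) : Fin (k + 2) → ℕ :=
  Function.extend (skipPair hij) y 0

theorem extendPair_skip (y : Fin k → ℕ) (a : Fin k) : extendPair hij y (skipPair hij a) = y a :=
  (skipPair hij).injective.extend_apply _ _ _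

theorem extendPair_left (y : Fin k → ℕ) : extendPair hij y i = 0 :=
  Function.extend_apply' _ _ _ fun ⟨a, ha⟩ => skipPair_ne_left hij a ha

theorem extendPair_right (y : Fin k → ℕ) : extendPair hij y j = 0 :=
  Function.extend_apply' _ _ _ fun ⟨a, ha⟩ => skipPair_ne_right hij a ha

theorem extendPair_comp (y : Fin k → ℕ) : extendPair hij y ∘ skipPair hij = y :=
  funext (extendPair_skip hij y)

theorem extendPair_injective : Function.Injective (extendPair hij) := fun y z h => by
  rw [← extendPair_comp hij y, h, extendPair_comp]

theorem extendPair_eq_iff {y : Fin k → ℕ} {z : Fin (k + 2) → ℕ} :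
    extendPair hij y = z ↔ z i = 0 ∧ z j = 0 ∧ ∀ a, y a = z (skipPair hij a) := by
  constructor
  · rintro rfl
    exact ⟨extendPair_left hij y, extendPair_right hij y, fun a => (extendPair_skip hij y a).symm⟩
  · rintro ⟨hi, hj, h⟩
    funext a
    by_cases ha : a = i
    · rw [ha, hi, extendPair_left]
    by_cases hb : a = j
    · rw [hb, hj, extendPair_right]
    obtain ⟨b, rfl⟩ := (range_skipPair hij a).2 ⟨ha, hb⟩
    rw [extendPair_skip, h]

theorem extendPair_zero : extendPair hij 0 = 0 := by
  rw [extendPair_eq_iff]; simp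

theorem extendPair_single (a : Fin k) :
    extendPair hij (Pi.single a 1) = Pi.single (skipPair hij a) 1 := by
  rw [extendPair_eq_iff]
  refine ⟨?_, ?_, fun b => ?_⟩
  · simp [(skipPair_ne_left hij a).symm]
  · simp [(skipPair_ne_right hij a).symm]
  · simp [Pi.single_apply]

theorem extendPair_edge (a b : Fin k) :
    extendPair hij (edge a b) = edge (skipPair hij a) (skipPair hij b) := by
  rw [extendPair_eq_iff]
  refine ⟨?_, ?_, fun d => ?_⟩
  · simp [edge, (skipPair_ne_left hij _).symm]
  · simp [edge, (skipPair_ne_right hij _).symm]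
  · simp [edge, Pi.single_apply]

/-- Adjoin the isolated edge `{i, j}` to a partition in the remaining variables. -/
noncomputable def adjoinPair (l : Finset (Fin k → ℕ)) : Finset (Fin (k + 2) → ℕ) :=
  l.image (extendPair hij) ∪ {Pi.single i 1, Pi.single j 1, edge i j}

/-- The part of a partition in the variables other than `i` and `j`. -/
noncomputable def restrictPair (l : Finset (Fin (k + 2) → ℕ)) : Finset (Fin k → ℕ) :=
  l.preimage (extendPair hij) (extendPair_injective hij).injOn

theorem mem_restrictPair {l : Finset (Fin (k + 2) → ℕ)} {y : Fin k → ℕ} :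
    y ∈ restrictPair hij l ↔ extendPair hij y ∈ l := by
  simp [restrictPair]

theorem mem_adjoinPair {l : Finset (Fin k → ℕ)} {y : Fin (k + 2) → ℕ} :
    y ∈ adjoinPair hij l ↔
      (∃ z ∈ l, extendPair hij z = y) ∨ y = Pi.single i 1 ∨ y = Pi.single j 1 ∨ y = edge i j := by
  simp only [adjoinPair, mem_union, mem_image, mem_insert, mem_singleton]

theorem extendPair_ne {y : Fin k → ℕ} : ¬ (extendPair hij y = Pi.single i 1 ∨
    extendPair hij y = Pi.single j 1 ∨ extendPair hij y = edge i j) := by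
  rintro (h | h | h)
  · have := congrFun h i
    simp [extendPair_left] at this
  · have := congrFun h j
    simp [extendPair_right] at this
  · have := congrFun h i
    simp [extendPair_left, edge, hij] at this

theorem extendPair_mem_adjoinPair {l : Finset (Fin k → ℕ)} {y : Fin k → ℕ} :
    extendPair hij y ∈ adjoinPair hij l ↔ y ∈ l := by
  rw [mem_adjoinPair]
  constructor
  · rintro (⟨z, hz, h⟩ | h)
    · rwa [← extendPair_injective hij h]
    · exact (extendPair_ne hij h).elim
  · exact fun h => Or.inl ⟨y, h, rfl⟩

theorem restrictPair_adjoinPair (l : Finset (Fin k → ℕ)) :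
    restrictPair hij (adjoinPair hij l) = l := by
  ext y
  rw [mem_restrictPair, extendPair_mem_adjoinPair]

theorem card_adjoinPair (l : Finset (Fin k → ℕ)) :
    (adjoinPair hij l).card = l.card + 3 := by
  rw [adjoinPair, card_union_of_disjoint, card_image_of_injective _ (extendPair_injective hij)]
  · congr 1
    refine card_eq_three.2 ⟨_, _, _, ?_, ?_, ?_, rfl⟩
    · exact fun h => hij (single_one_injective h)
    · intro h
      have := congrArg deg h
      rw [deg_single, deg_edge] at this
      omega
    · intro h
      have := congrArg deg h
      rw [deg_single, deg_edge] at this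
      omega
  · rw [disjoint_left]
    intro y hy hy2
    obtain ⟨z, -, rfl⟩ := mem_image.1 hy
    exact extendPair_ne hij (by simpa using hy2)

theorem isolatedPair_adjoinPair_self (l : Finset (Fin k → ℕ)) :
    IsolatedPair (adjoinPair hij l) i j := by
  refine ⟨(mem_adjoinPair hij).2 (by simp), fun y hy h => ?_⟩
  rcases (mem_adjoinPair hij).1 hy with ⟨z, -, rfl⟩ | h'
  · simp [extendPair_left, extendPair_right] at h
  · exact h'

theorem adjoinPair_restrictPair {l : Finset (Fin (k + 2) → ℕ)}
    (hl : IsLowerSet (l : Set (Fin (k + 2) → ℕ))) (h : IsolatedPair l i j) :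
    adjoinPair hij (restrictPair hij l) = l := by
  ext y
  rw [mem_adjoinPair]
  constructor
  · rintro (⟨z, hz, rfl⟩ | rfl | rfl | rfl)
    · exact (mem_restrictPair hij).1 hz
    · exact hl (single_le_edge i j) h.1
    · exact hl (edge_comm i j ▸ single_le_edge j i) h.1
    · exact h.1
  · intro hy
    by_cases h0 : y i ≠ 0 ∨ y j ≠ 0
    · exact Or.inr (h.2 y hy h0)
    · push Not at h0
      have hx : extendPair hij (y ∘ skipPair hij) = y :=
        (extendPair_eq_iff hij).2 ⟨h0.1, h0.2, fun a => rfl⟩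
      exact Or.inl ⟨_, (mem_restrictPair hij).2 (by rwa [hx]), hx⟩

theorem isThick_adjoinPair {e : ℕ} {l : Finset (Fin k → ℕ)} (h : IsThick e l) :
    IsThick (e + 1) (adjoinPair hij l) := by
  have h0 : (0 : Fin (k + 2) → ℕ) ∈ adjoinPair hij l := by
    rw [← extendPair_zero hij, extendPair_mem_adjoinPair]
    exact h.2.2.1
  have hedge : edge i j ∈ adjoinPair hij l := (isolatedPair_adjoinPair_self hij l).1
  refine ⟨?_, ?_, h0, fun a => ?_⟩
  · intro y z hzy hy
    rw [mem_coe, mem_adjoinPair] at hy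
    have aux : z ≤ edge i j → z ∈ adjoinPair hij l := by
      intro hz
      rcases eq_of_le_edge hij hz with rfl | hz
      · exact h0
      · exact (mem_adjoinPair hij).2 (Or.inr hz)
    rcases hy with ⟨y, hy, rfl⟩ | rfl | rfl | rfl
    · have hx : extendPair hij (z ∘ skipPair hij) = z := by
        refine (extendPair_eq_iff hij).2 ⟨?_, ?_, fun a => rfl⟩
        · have := hzy i
          rw [extendPair_left] at this
          exact Nat.le_zero.1 this
        · have := hzy j
          rw [extendPair_right] at this
          exact Nat.le_zero.1 this
      rw [mem_coe, ← hx, extendPair_mem_adjoinPair]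
      refine h.1 (fun a => ?_) hy
      have := hzy (skipPair hij a)
      rwa [extendPair_skip] at this
    · exact aux (hzy.trans (single_le_edge i j))
    · exact aux (hzy.trans (edge_comm i j ▸ single_le_edge j i))
    · exact aux hzy
  -- Three new points against two new variables: the excess `e` grows by one.
  · rw [card_adjoinPair, h.2.1]; omega
  · by_cases ha : a = i
    · exact ⟨j, ha ▸ hedge⟩
    by_cases hb : a = j
    · exact ⟨i, by rw [hb, edge_comm]; exact hedge⟩
    obtain ⟨b, rfl⟩ := (range_skipPair hij a).2 ⟨ha, hb⟩
    obtain ⟨d, hd⟩ := h.2.2.2 b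
    refine ⟨skipPair hij d, ?_⟩
    rw [← extendPair_edge, extendPair_mem_adjoinPair]
    exact hd

theorem isThick_restrictPair {e : ℕ} {l : Finset (Fin (k + 2) → ℕ)} (h : IsThick (e + 1) l)
    (hp : IsolatedPair l i j) : IsThick e (restrictPair hij l) := by
  refine ⟨?_, ?_, ?_, fun a => ?_⟩
  · intro y z hzy hy
    rw [mem_coe, mem_restrictPair] at hy ⊢
    refine h.1 (fun a => ?_) hy
    by_cases ha : a = i
    · rw [ha, extendPair_left]; exact Nat.zero_le _
    by_cases hb : a = j
    · rw [hb, extendPair_right]; exact Nat.zero_le _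
    obtain ⟨b, rfl⟩ := (range_skipPair hij a).2 ⟨ha, hb⟩
    rw [extendPair_skip, extendPair_skip]
    exact hzy b
  · have := card_adjoinPair hij (restrictPair hij l)
    rw [adjoinPair_restrictPair hij h.1 hp, h.2.1] at this
    omega
  · rw [mem_restrictPair, extendPair_zero]; exact h.2.2.1
  · obtain ⟨b, hb⟩ := h.2.2.2 (skipPair hij a)
    have hne := hp.2 _ hb
    -- A neighbour of an outside vertex is outside as well: otherwise the edge would be one of the
    -- three points meeting `{i, j}`, and none of these involves an outside vertex.
    have hbi : b ≠ i ∧ b ≠ j := by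
      by_contra hcon
      have hcon : edge (skipPair hij a) b i ≠ 0 ∨ edge (skipPair hij a) b j ≠ 0 := by
        by_cases hbi : b = i
        · left; rw [hbi]; exact edge_right_ne_zero _ _
        · have : b = j := by tauto
          right; rw [this]; exact edge_right_ne_zero _ _
      have ha := edge_left_ne_zero (skipPair hij a) b
      rcases hne hcon with h | h | h <;> rw [h] at ha <;>
        simp [edge, skipPair_ne_left, skipPair_ne_right] at ha
    obtain ⟨d, rfl⟩ := (range_skipPair hij b).2 hbi
    exact ⟨d, by rwa [mem_restrictPair, extendPair_edge]⟩

theorem isolatedPair_adjoinPair_skip {l : Finset (Fin k → ℕ)} {a b : Fin k} :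
    IsolatedPair (adjoinPair hij l) (skipPair hij a) (skipPair hij b) ↔ IsolatedPair l a b := by
  unfold IsolatedPair
  rw [← extendPair_edge, extendPair_mem_adjoinPair]
  refine and_congr_right fun _ => ?_
  constructor
  · intro h y hy hne
    have := h (extendPair hij y) ((extendPair_mem_adjoinPair hij).2 hy)
      (by rwa [extendPair_skip, extendPair_skip])
    rw [← extendPair_single, ← extendPair_single] at this
    simpa only [(extendPair_injective hij).eq_iff] using this
  · intro h y hy hne
    rcases (mem_adjoinPair hij).1 hy with ⟨z, hz, rfl⟩ | hy
    · rw [extendPair_skip, extendPair_skip] at hne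
      rw [← extendPair_single, ← extendPair_single]
      simpa only [(extendPair_injective hij).eq_iff] using h z hz hne
    · exfalso
      rcases hy with rfl | rfl | rfl <;>
        simp [edge, skipPair_ne_left, skipPair_ne_right] at hne

/-- An edge of the enlarged partition either comes from the old variables or is `{i, j}` itself.
Monotonicity of `skipPair` keeps the endpoints in increasing order. -/
theorem isolatedPairs_adjoinPair (hlt : i < j) (l : Finset (Fin k → ℕ)) :
    isolatedPairs (adjoinPair hij l) =
      insert (i, j) ((isolatedPairs l).image (Prod.map (skipPair hij) (skipPair hij))) := by
  ext ⟨u, v⟩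
  simp only [mem_insert, mem_image, mem_isolatedPairs, Prod.mk.injEq, Prod.exists, Prod.map]
  constructor
  · rintro ⟨huv, h⟩
    rcases (mem_adjoinPair hij).1 h.1 with ⟨z, hz, hzu⟩ | h'
    · right
      have hu : u ≠ i ∧ u ≠ j := by
        constructor <;> rintro rfl <;> have := edge_left_ne_zero u v <;> rw [← hzu] at this
        · exact this (extendPair_left hij z)
        · exact this (extendPair_right hij z)
      have hv : v ≠ i ∧ v ≠ j := by
        constructor <;> rintro rfl <;> have := edge_right_ne_zero u v <;> rw [← hzu] at this
        · exact this (extendPair_left hij z)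
        · exact this (extendPair_right hij z)
      obtain ⟨a, rfl⟩ := (range_skipPair hij u).2 hu
      obtain ⟨b, rfl⟩ := (range_skipPair hij v).2 hv
      exact ⟨a, b, ⟨(skipPair hij).lt_iff_lt.1 huv, (isolatedPair_adjoinPair_skip hij).1 h⟩, rfl,
        rfl⟩
    · left
      have he : edge u v = edge i j := by
        rcases h' with h' | h' | h'
        · have := congrArg deg h'
          rw [deg_edge, deg_single] at this
          omega
        · have := congrArg deg h'
          rw [deg_edge, deg_single] at this
          omega
        · exact h'
      have hu := edge_left_ne_zero u v
      have hv := edge_right_ne_zero u v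
      rw [he, edge_apply_ne_zero] at hu hv
      rcases hu with rfl | rfl <;> rcases hv with rfl | rfl
      · exact absurd huv (lt_irrefl _)
      · exact ⟨rfl, rfl⟩
      · exact absurd huv hlt.not_gt
      · exact absurd huv (lt_irrefl _)
  · rintro (⟨rfl, rfl⟩ | ⟨a, b, ⟨hab, h⟩, rfl, rfl⟩)
    · exact ⟨hlt, isolatedPair_adjoinPair_self hij l⟩
    · exact ⟨(skipPair hij).lt_iff_lt.2 hab, (isolatedPair_adjoinPair_skip hij).2 h⟩

theorem card_isolatedPairs_adjoinPair (hlt : i < j) (l : Finset (Fin k → ℕ)) :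
    (isolatedPairs (adjoinPair hij l)).card = (isolatedPairs l).card + 1 := by
  rw [isolatedPairs_adjoinPair hij hlt, card_insert_of_notMem, card_image_of_injective]
  · exact (skipPair hij).injective.prodMap (skipPair hij).injective
  · simp only [mem_image, Prod.exists, Prod.map, Prod.mk.injEq, not_exists, not_and]
    exact fun a b _ h => absurd h (skipPair_ne_left hij a)

end skip

/-! ### Counting by the number of isolated edges -/

/-- The number of thick partitions with exactly `m` isolated edges. -/
noncomputable def cIso (k e m : ℕ) : ℕ :=
  ((thick k e).filter fun l => (isolatedPairs l).card = m).card

open Classical in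
theorem card_filter_isolatedPair {k : ℕ} {i j : Fin (k + 2)} (hlt : i < j) (e m : ℕ) :
    ((thick (k + 2) (e + 1)).filter fun l =>
      (isolatedPairs l).card = m + 1 ∧ IsolatedPair l i j).card = cIso k e m := by
  symm
  refine card_nbij' (adjoinPair hlt.ne) (restrictPair hlt.ne) ?_ ?_ ?_ ?_
  · intro l hl
    simp only [coe_filter, mem_thick, Set.mem_ofPred_eq] at hl ⊢
    exact ⟨isThick_adjoinPair _ hl.1, by rw [card_isolatedPairs_adjoinPair _ hlt, hl.2],
      isolatedPair_adjoinPair_self _ l⟩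
  · intro l hl
    simp only [coe_filter, mem_thick, Set.mem_ofPred_eq] at hl ⊢
    refine ⟨isThick_restrictPair _ hl.1 hl.2.2, ?_⟩
    have := card_isolatedPairs_adjoinPair hlt.ne hlt (restrictPair hlt.ne l)
    rw [adjoinPair_restrictPair _ hl.1.1 hl.2.2, hl.2.1] at this
    omega
  · intro l _
    exact restrictPair_adjoinPair _ l
  · intro l hl
    simp only [coe_filter, mem_thick, Set.mem_ofPred_eq] at hl
    exact adjoinPair_restrictPair _ hl.1.1 hl.2.2

theorem card_filter_lt (n : ℕ) :
    (univ.filter fun p : Fin n × Fin n => p.1 < p.2).card * 2 = n * (n - 1) := by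
  have : (univ.filter fun p : Fin n × Fin n => p.1 < p.2).card = ∑ j : Fin n, (j : ℕ) := by
    rw [card_filter, ← univ_product_univ, sum_product_right]
    refine sum_congr rfl fun j _ => ?_
    rw [← card_filter]
    have : (univ.filter fun i : Fin n => i < j) = Iio j := by ext; simp
    rw [this, Fin.card_Iio]
  rw [this, Fin.sum_univ_eq_sum_range (fun i => i), sum_range_id_mul_two]

/-- Double counting of pairs (partition, one of its isolated edges): each of the `(k+2)(k+1)/2`
possible edges is isolated in `cIso k e m` of the partitions. -/
theorem cIso_succ (k e m : ℕ) :
    (m + 1) * cIso (k + 2) (e + 1) (m + 1) * 2 = (k + 2) * (k + 1) * cIso k e m := by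
  classical
  have h := sum_card_bipartiteAbove_eq_sum_card_bipartiteBelow
    (s := (thick (k + 2) (e + 1)).filter fun l => (isolatedPairs l).card = m + 1)
    (t := univ.filter fun p : Fin (k + 2) × Fin (k + 2) => p.1 < p.2)
    (fun l p => IsolatedPair l p.1 p.2)
  rw [sum_congr rfl (g := fun _ => m + 1), sum_congr (s₁ := univ.filter _) rfl
    (g := fun _ => cIso k e m), sum_const, sum_const] at h
  · have h2 := card_filter_lt (k + 2)
    simp only [smul_eq_mul] at h
    rw [show k + 2 - 1 = k + 1 by omega] at h2
    rw [← h2]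
    change cIso (k + 2) (e + 1) (m + 1) * (m + 1) = _ at h
    linear_combination 2 * h
  · intro p hp
    rw [bipartiteBelow, filter_filter]
    exact card_filter_isolatedPair (mem_filter.1 hp).2 e m
  · intro l hl
    rw [← (mem_filter.1 hl).2, bipartiteAbove, filter_filter]
    rfl

/-! ### The bound `2k ≤ 3e` without isolated edges -/

theorem edge_le_of_ne {n : ℕ} {i j : Fin n} (hij : i ≠ j) {y : Fin n → ℕ} (hi : y i ≠ 0)
    (hj : y j ≠ 0) : edge i j ≤ y := by
  intro a
  by_cases ha : a = i
  · subst ha; simp [edge, hij]; omega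
  · by_cases hb : a = j
    · subst hb; simp [edge, ha]; omega
    · simp [edge, ha, hb]

theorem edge_self_le {n : ℕ} {i : Fin n} {y : Fin n → ℕ} (hi : 2 ≤ y i) : edge i i ≤ y := by
  intro a
  by_cases ha : a = i
  · subst ha; simpa [edge] using hi
  · simp [edge, ha]

theorem exists_eq_edge {n : ℕ} {y : Fin n → ℕ} (hy : deg y = 2) : ∃ i j, y = edge i j := by
  obtain ⟨i, hi⟩ : ∃ i, y i ≠ 0 := by
    by_contra! hcon
    simp [deg, hcon] at hy
  obtain ⟨j, hj⟩ := exists_edge_le hi hy.ge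
  refine ⟨i, j, ?_⟩
  by_contra hne
  have := deg_lt_deg (lt_of_le_of_ne hj (Ne.symm hne))
  rw [deg_edge] at this
  omega

/-- Any point involving `i` or `j` but not below `eᵢ + eⱼ` would, by downward closure, produce a
loop or a second edge at `i` or `j`. -/
theorem isolatedPair_of_forall {n : ℕ} {l : Finset (Fin n → ℕ)}
    (hl : IsLowerSet (l : Set (Fin n → ℕ))) {i j : Fin n} (hij : i ≠ j) (he : edge i j ∈ l)
    (hi : ∀ b, edge i b ∈ l → b = j) (hj : ∀ b, edge j b ∈ l → b = i) : IsolatedPair l i j := by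
  refine ⟨he, fun y hy hne => ?_⟩
  have hle : y ≤ edge i j := by
    intro a
    by_cases ha : a = i
    · subst ha
      have : y a ≤ 1 := by
        by_contra hcon
        exact hij (hi a (hl (edge_self_le (by omega)) hy))
      simpa [edge, hij] using this
    by_cases hb : a = j
    · subst hb
      have : y a ≤ 1 := by
        by_contra hcon
        exact hij (hj a (hl (edge_self_le (by omega)) hy)).symm
      simpa [edge, hij.symm] using this
    have : y a = 0 := by
      by_contra hcon
      rcases hne with h | h
      · exact hb (hi a (hl (edge_le_of_ne (Ne.symm ha) h hcon) hy))
      · exact ha (hj a (hl (edge_le_of_ne (Ne.symm hb) h hcon) hy))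
    rw [this]
    exact Nat.zero_le _
  rcases eq_of_le_edge hij hle with rfl | h
  · simp at hne
  · exact h

/-- Degrees `0` and `1` already use `1 + k` of the `1 + k + e` points. -/
theorem IsThick.card_filter_deg_two_le {k e : ℕ} {l : Finset (Fin k → ℕ)} (h : IsThick e l) :
    (l.filter fun y => deg y = 2).card ≤ e := by
  have h1 : (l.filter fun y => deg y = 1).card = k := hilbertSamuel_one_eq_iff.2 h.single_mem
  have h0 : 0 < (l.filter fun y => deg y = 0).card :=
    card_pos.2 ⟨0, mem_filter.2 ⟨h.2.2.1, deg_eq_zero_iff.2 rfl⟩⟩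
  have hsum : (l.filter fun y => deg y = 0).card + (l.filter fun y => deg y = 1).card +
      (l.filter fun y => deg y = 2).card ≤ l.card := by
    rw [← card_union_of_disjoint, ← card_union_of_disjoint]
    · exact card_le_card (union_subset (union_subset (filter_subset _ _) (filter_subset _ _))
        (filter_subset _ _))
    · rw [disjoint_left]
      intro y hy hy2
      simp only [mem_union, mem_filter] at hy hy2
      omega
    · rw [disjoint_left]
      intro y hy hy2
      simp only [mem_filter] at hy hy2
      omega
  have := h.2.1
  omega

/-- Discharging: a vertex on a single edge draws `4` from it, any other vertex draws `2` from each
of its edges. Every vertex receives at least `4`. Every edge pays at most `6`, since an edge paying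
`4` at both ends would be isolated. Hence `4k ≤ 6e`. -/
theorem IsThick.two_mul_le {k e : ℕ} {l : Finset (Fin k → ℕ)} (h : IsThick e l)
    (h0 : isolatedPairs l = ∅) : 2 * k ≤ 3 * e := by
  classical
  set E := l.filter fun y => deg y = 2 with hE
  let d : Fin k → ℕ := fun i => (E.filter fun y => y i ≠ 0).card
  let w : Fin k → ℕ := fun i => if d i = 1 then 4 else 2
  have hmem : ∀ {i j}, edge i j ∈ l → edge i j ∈ E := fun hm =>
    mem_filter.2 ⟨hm, deg_edge _ _⟩
  have hw4 : ∀ i, w i ≤ 4 := fun i => by dsimp only [w]; split_ifs <;> omega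
  have hvertex : ∀ i, 4 ≤ ∑ y ∈ E, if y i ≠ 0 then w i else 0 := by
    intro i
    rw [← sum_filter, sum_const, smul_eq_mul]
    change 4 ≤ d i * w i
    have hpos : 0 < d i := by
      obtain ⟨j, hj⟩ := h.2.2.2 i
      exact card_pos.2 ⟨_, mem_filter.2 ⟨hmem hj, edge_left_ne_zero i j⟩⟩
    dsimp only [w]
    split_ifs <;> omega
  have huniq : ∀ i j, i ≠ j → edge i j ∈ l → d i = 1 → ∀ b, edge i b ∈ l → b = j := by
    intro i j hij he hd b hb
    obtain ⟨y, hy⟩ := card_eq_one.1 hd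
    have h1 : edge i j ∈ E.filter fun y => y i ≠ 0 :=
      mem_filter.2 ⟨hmem he, edge_left_ne_zero i j⟩
    have h2 : edge i b ∈ E.filter fun y => y i ≠ 0 :=
      mem_filter.2 ⟨hmem hb, edge_left_ne_zero i b⟩
    rw [hy, mem_singleton] at h1 h2
    have h3 := edge_right_ne_zero i j
    rw [h1, ← h2, edge_apply_ne_zero] at h3
    rcases h3 with h3 | h3
    · exact absurd h3.symm hij
    · exact h3.symm
  have hedge : ∀ y ∈ E, (∑ i, if y i ≠ 0 then w i else 0) ≤ 6 := by
    intro y hy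
    obtain ⟨hyl, hy2⟩ := mem_filter.1 hy
    obtain ⟨i, j, rfl⟩ := exists_eq_edge hy2
    simp only [edge_apply_ne_zero]
    by_cases hij : i = j
    · subst hij
      simp only [or_self, sum_ite_eq', mem_univ, if_true]
      exact (hw4 i).trans (by omega)
    · rw [← sum_filter]
      have : (univ.filter fun a => a = i ∨ a = j) = {i, j} := by ext a; simp
      rw [this, sum_pair hij]
      by_cases hd : d i = 1 ∧ d j = 1
      · exfalso
        have hiso : ∀ {a b : Fin k}, a ≠ b → edge a b ∈ l → d a = 1 → d b = 1 →
            IsolatedPair l a b := fun {a b} hab he ha hb =>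
          isolatedPair_of_forall h.1 hab he (huniq a b hab he ha)
            (huniq b a hab.symm (edge_comm a b ▸ he) hb)
        rcases lt_or_gt_of_ne hij with hlt | hlt
        · have : (i, j) ∈ isolatedPairs l :=
            mem_isolatedPairs.2 ⟨hlt, hiso hij hyl hd.1 hd.2⟩
          simp [h0] at this
        · have : (j, i) ∈ isolatedPairs l :=
            mem_isolatedPairs.2 ⟨hlt, hiso (Ne.symm hij) (edge_comm i j ▸ hyl) hd.2 hd.1⟩
          simp [h0] at this
      · dsimp only [w]
        split_ifs <;> omega
  have h1 : 4 * k ≤ ∑ i : Fin k, ∑ y ∈ E, if y i ≠ 0 then w i else 0 := by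
    calc 4 * k = ∑ _i : Fin k, 4 := by simp [mul_comm]
      _ ≤ _ := sum_le_sum fun i _ => hvertex i
  rw [sum_comm] at h1
  have h2 : (∑ y ∈ E, ∑ i, if y i ≠ 0 then w i else 0) ≤ 6 * E.card := by
    calc _ ≤ ∑ _y ∈ E, 6 := sum_le_sum hedge
      _ = 6 * E.card := by simp [mul_comm]
  have h3 : E.card ≤ e := h.card_filter_deg_two_le
  omega

theorem two_mul_le_of_cIso_zero_ne {k e : ℕ} (h : cIso k e 0 ≠ 0) : 2 * k ≤ 3 * e := by
  obtain ⟨l, hl⟩ := card_pos.1 (Nat.pos_of_ne_zero h)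
  obtain ⟨hl, h0⟩ := mem_filter.1 hl
  exact (mem_thick.1 hl).two_mul_le (card_eq_zero.1 h0)

theorem cIso_succ_ne_zero {k e m : ℕ} (h : cIso k e (m + 1) ≠ 0) : 2 ≤ k ∧ 1 ≤ e := by
  obtain ⟨l, hl⟩ := card_pos.1 (Nat.pos_of_ne_zero h)
  obtain ⟨hl, h0⟩ := mem_filter.1 hl
  obtain ⟨p, hp⟩ := card_pos.1 (h0 ▸ Nat.succ_pos m : 0 < (isolatedPairs l).card)
  obtain ⟨hlt, hiso⟩ := mem_isolatedPairs.1 hp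
  constructor
  · have := p.2.isLt
    have := Fin.lt_def.1 hlt
    omega
  · refine le_trans ?_ (mem_thick.1 hl).card_filter_deg_two_le
    exact card_pos.2 ⟨_, mem_filter.2 ⟨hiso.1, deg_edge _ _⟩⟩

/-! ### Reduction to partitions without isolated edges -/

theorem two_mul_le_of_cIso_ne_zero {m : ℕ} : ∀ {k e : ℕ}, cIso k e m ≠ 0 → 2 * m ≤ k := by
  induction m with
  | zero => intros; omega
  | succ m ih =>
    intro k e h
    obtain ⟨hk, he⟩ := cIso_succ_ne_zero h
    obtain ⟨k, rfl⟩ := Nat.exists_eq_add_of_le' hk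
    obtain ⟨e, rfl⟩ := Nat.exists_eq_add_of_le' he
    have hs := cIso_succ k e m
    have : cIso k e m ≠ 0 := by
      intro h0
      rw [h0, mul_zero] at hs
      simp [h] at hs
    have := ih this
    omega

theorem cIso_add (k e m : ℕ) :
    cIso (k + 2 * m) (e + m) m * (2 ^ m * m ! * k !) = (k + 2 * m)! * cIso k e 0 := by
  induction m with
  | zero => simp [mul_comm]
  | succ m ih =>
    have hs := cIso_succ (k + 2 * m) (e + m) m
    rw [show k + 2 * (m + 1) = k + 2 * m + 2 by ring, ← add_assoc]
    rw [Nat.factorial_succ (k + 2 * m + 1), Nat.factorial_succ (k + 2 * m), Nat.factorial_succ m,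
      pow_succ]
    linear_combination (2 ^ m * m ! * k !) * hs + (k + 2 * m + 2) * (k + 2 * m + 1) * ih

/-- The index `j = N - m` replaces the number `m` of isolated edges, so that the remaining factor
`cIso (2j+ε) (j+α) 0` does not depend on `N`. The condition `ε ≤ 1` turns `2m ≤ 2N + ε` into `m ≤
N`. -/
theorem card_thick (N ε α : ℕ) (hε : ε ≤ 1) :
    ((thick (2 * N + ε) (N + α)).card : ℚ) =
      ∑ j ∈ range (N + 1), (cIso (2 * j + ε) (j + α) 0 : ℚ) *
        ((2 * N + ε)! / (2 ^ (N - j) * (N - j)! * (2 * j + ε)!)) := by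
  have h1 : (thick (2 * N + ε) (N + α)).card =
      ∑ m ∈ range (N + 1), cIso (2 * N + ε) (N + α) m := by
    refine card_eq_sum_card_fiberwise fun l hl => ?_
    have hne : cIso (2 * N + ε) (N + α) (isolatedPairs l).card ≠ 0 :=
      card_ne_zero_of_mem (a := l) (mem_filter.2 ⟨hl, rfl⟩)
    have := two_mul_le_of_cIso_ne_zero hne
    simp only [coe_range, Set.mem_Iio]
    omega
  rw [h1, ← sum_range_reflect, Nat.cast_sum]
  refine sum_congr rfl fun j hj => ?_
  have hj : j ≤ N := by simpa [Nat.lt_succ_iff] using hj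
  obtain ⟨m, rfl⟩ := Nat.exists_eq_add_of_le hj
  have h := cIso_add (2 * j + ε) (j + α) m
  rw [show j + m + 1 - 1 - j = m by omega, show j + m - j = m by omega,
    show 2 * (j + m) + ε = 2 * j + ε + 2 * m by ring, show j + m + α = j + α + m by ring,
    mul_div_assoc', eq_div_iff (by positivity)]
  rw [mul_comm _ ((2 * j + ε + 2 * m)! : ℚ)]
  exact_mod_cast h

theorem cIso_zero_succ (e : ℕ) : cIso 0 (e + 1) 0 = 0 := by
  by_contra h
  obtain ⟨l, hl⟩ := card_pos.1 (Nat.pos_of_ne_zero h)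
  have := (mem_thick.1 (mem_filter.1 hl).1).2.1
  have h2 := card_le_univ l
  simp at h2
  omega

theorem cIso_zero_zero : cIso 0 0 0 = 1 := by
  refine card_eq_one.2 ⟨{0}, ?_⟩
  ext l
  rw [mem_filter, mem_thick, mem_singleton]
  constructor
  · rintro ⟨h, -⟩
    ext y
    rw [Subsingleton.elim y 0]
    simpa using h.2.2.1
  · rintro rfl
    refine ⟨⟨fun a b _ h => ?_, by simp, by simp, fun i => i.elim0⟩, ?_⟩
    · rwa [Subsingleton.elim b a]
    · rw [card_eq_zero, eq_empty_iff_forall_notMem]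
      exact fun p => p.1.elim0

/-! ### Powers of `1 - 2t` and exponential inversion -/

theorem coeff_oneSubTwoPow (r : ℚ) (n : ℕ) :
    PowerSeries.coeff n (oneSubTwoPow r) = (-2) ^ n * Ring.choose r n := by
  simp [oneSubTwoPow]

theorem oneSubTwoPow_add (r s : ℚ) :
    oneSubTwoPow (r + s) = oneSubTwoPow r * oneSubTwoPow s := by
  rw [oneSubTwoPow, PowerSeries.binomialSeries_add, map_mul]
  rfl

/-- The polynomial `1 - 2t`. -/
noncomputable def oneSubTwoX : Polynomial ℚ := 1 + Polynomial.C (-2) * Polynomial.X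

theorem coe_oneSubTwoX_pow (m : ℕ) :
    ((oneSubTwoX ^ m : Polynomial ℚ) : PowerSeries ℚ) = oneSubTwoPow m := by
  rw [oneSubTwoPow, PowerSeries.binomialSeries_nat, map_pow, Polynomial.coe_pow, map_add, map_one,
    PowerSeries.rescale_X, oneSubTwoX, Polynomial.coe_add, Polynomial.coe_one, Polynomial.coe_mul,
    Polynomial.coe_C, Polynomial.coe_X]

theorem coeff_oneSubTwoX_pow (m h : ℕ) :
    (oneSubTwoX ^ m).coeff h = (m.choose h : ℚ) * (-2) ^ h := by
  have : oneSubTwoX ^ m =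
      ((1 + Polynomial.X) ^ m : Polynomial ℚ).comp (Polynomial.C (-2) * Polynomial.X) := by
    simp [oneSubTwoX]
  rw [this, Polynomial.comp_C_mul_X_coeff, Polynomial.coeff_one_add_X_pow]

theorem natDegree_oneSubTwoX_pow_le (m : ℕ) : (oneSubTwoX ^ m).natDegree ≤ m := by
  rw [Polynomial.natDegree_le_iff_coeff_eq_zero]
  intro N hN
  rw [coeff_oneSubTwoX_pow, Nat.choose_eq_zero_of_lt hN]
  simp

/-- Each step of the binomial series multiplies by `-2 (-(3/2+j) - n) / (n+1) = (2(n+j)+3) / (n+1)`,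
which extends the double factorial by one factor. -/
theorem choose_neg_three_half_sub (j n : ℕ) :
    (-2) ^ n * Ring.choose (-(3 / 2 + (j : ℚ))) n * ((2 * j + 1)‼ : ℚ) * (n ! : ℚ) =
      ((2 * (n + j) + 1)‼ : ℚ) := by
  induction n with
  | zero => simp
  | succ n ih =>
    have h := Ring.choose_smul_choose (-(3 / 2 + (j : ℚ))) (Nat.le_succ n)
    rw [Nat.choose_succ_self_right, Nat.succ_sub (le_refl n), Nat.sub_self, Ring.choose_one_right,
      nsmul_eq_mul] at h
    rw [show 2 * (n + 1 + j) + 1 = 2 * (n + j) + 1 + 2 by ring, Nat.doubleFactorial_add_two,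
      Nat.factorial_succ, pow_succ]
    push_cast at h ih ⊢
    linear_combination (-2) ^ n * (-2) * ((2 * j + 1)‼ : ℚ) * (n ! : ℚ) * h +
      (2 * ((n : ℚ) + j) + 3) * ih

/-- The polynomial `(2j+1)‼ tʲ (1-2t)^(D-j)`. -/
noncomputable def basisPoly (D j : ℕ) : Polynomial ℚ :=
  Polynomial.C ((2 * j + 1)‼ : ℚ) * (Polynomial.X ^ j * oneSubTwoX ^ (D - j))

theorem natDegree_basisPoly_le {D j : ℕ} (hj : j ≤ D) : (basisPoly D j).natDegree ≤ D := by
  refine (Polynomial.natDegree_C_mul_le _ _).trans (Polynomial.natDegree_mul_le.trans ?_)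
  have := natDegree_oneSubTwoX_pow_le (D - j)
  rw [Polynomial.natDegree_X_pow]
  omega

theorem coeff_basisPoly (D j h : ℕ) :
    (basisPoly D j).coeff h = if j ≤ h then
      ((2 * j + 1)‼ : ℚ) * (((D - j).choose (h - j) : ℚ) * (-2) ^ (h - j)) else 0 := by
  rw [basisPoly, Polynomial.coeff_C_mul, Polynomial.coeff_X_pow_mul', coeff_oneSubTwoX_pow]
  split_ifs <;> simp

/-- The factor `(1-2t)^(D-j)` cancels against the denominator, so the result is independent of `D`.
-/
theorem coeff_basisPoly_mul {D j : ℕ} (hj : j ≤ D) (n : ℕ) :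
    PowerSeries.coeff n ((basisPoly D j : PowerSeries ℚ) * oneSubTwoPow (-(3 / 2 + (D : ℚ)))) =
      if j ≤ n then ((2 * n + 1)‼ : ℚ) / ((n - j)! : ℚ) else 0 := by
  have h1 : (basisPoly D j : PowerSeries ℚ) * oneSubTwoPow (-(3 / 2 + (D : ℚ))) =
      PowerSeries.C ((2 * j + 1)‼ : ℚ) *
        (PowerSeries.X ^ j * oneSubTwoPow (-(3 / 2 + (j : ℚ)))) := by
    rw [show -(3 / 2 + (j : ℚ)) = ((D - j : ℕ) : ℚ) + -(3 / 2 + (D : ℚ)) by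
      rw [Nat.cast_sub hj]; ring, oneSubTwoPow_add, ← coe_oneSubTwoX_pow, basisPoly,
      Polynomial.coe_mul, Polynomial.coe_mul, Polynomial.coe_C, Polynomial.coe_pow,
      Polynomial.coe_X]
    ring
  rw [h1, PowerSeries.coeff_C_mul, PowerSeries.coeff_X_pow_mul', coeff_oneSubTwoPow]
  split_ifs with hjn
  · have := choose_neg_three_half_sub j (n - j)
    rw [Nat.sub_add_cancel hjn] at this
    rw [eq_div_iff (by positivity), ← this]
    ring
  · simp

/-- The hypothesis says that the series of `b` is that of `a` times `exp t`; multiply by `exp (-t)`.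
-/
theorem binomial_inversion {a b : ℕ → ℚ}
    (h : ∀ n, b n = ∑ j ∈ range (n + 1), a j / ((n - j)! : ℚ)) (n : ℕ) :
    a n = ∑ z ∈ range (n + 1), b z * ((-1) ^ (n - z) / ((n - z)! : ℚ)) := by
  have h1 : PowerSeries.mk b = PowerSeries.mk a * PowerSeries.exp ℚ := by
    ext n
    rw [PowerSeries.coeff_mul, Finset.Nat.sum_antidiagonal_eq_sum_range_succ_mk,
      PowerSeries.coeff_mk, h]
    refine sum_congr rfl fun j _ => ?_
    simp [PowerSeries.coeff_exp, div_eq_mul_inv]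
  have h2 : PowerSeries.mk a = PowerSeries.mk b * PowerSeries.evalNegHom (PowerSeries.exp ℚ) := by
    rw [h1, mul_assoc, PowerSeries.exp_mul_exp_neg_eq_one, mul_one]
  have h3 := congrArg (PowerSeries.coeff n) h2
  rw [PowerSeries.coeff_mul, Finset.Nat.sum_antidiagonal_eq_sum_range_succ_mk,
      PowerSeries.coeff_mk] at h3
  rw [h3]
  refine sum_congr rfl fun j _ => ?_
  simp [PowerSeries.evalNegHom, PowerSeries.coeff_exp, div_eq_mul_inv]

/-! ### Convergence to the analytic function -/

theorem hasSum_polynomial_mul {a : PowerSeries ℚ} {z s : ℂ}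
    (h : HasSum (fun n => z ^ n * ((PowerSeries.coeff n a : ℚ) : ℂ)) s) (p : Polynomial ℚ) :
    HasSum (fun n => z ^ n * ((PowerSeries.coeff n ((p : PowerSeries ℚ) * a) : ℚ) : ℂ))
      (Polynomial.aeval z p * s) := by
  induction p using Polynomial.induction_on with
  | C q =>
    simp only [Polynomial.coe_C, PowerSeries.coeff_C_mul, Polynomial.aeval_C, eq_ratCast,
      Rat.cast_mul]
    refine (h.mul_left (q : ℂ)).congr_fun fun n => ?_
    ring
  | add p q hp hq =>
    simp only [Polynomial.coe_add, add_mul, map_add, Rat.cast_add, mul_add]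
    exact hp.add hq
  | monomial n q ih =>
    have hX : ((Polynomial.C q * Polynomial.X ^ (n + 1) : Polynomial ℚ) : PowerSeries ℚ) * a =
        PowerSeries.X *
          (((Polynomial.C q * Polynomial.X ^ n : Polynomial ℚ) : PowerSeries ℚ) * a) := by
      simp only [Polynomial.coe_mul, Polynomial.coe_pow, Polynomial.coe_X]
      ring
    rw [hX]
    have h1 := ih.mul_left z
    have h2 := HasSum.zero_add (f := fun m => z ^ m * ((PowerSeries.coeff m (PowerSeries.X *
        (((Polynomial.C q * Polynomial.X ^ n : Polynomial ℚ) : PowerSeries ℚ) * a)) : ℚ) : ℂ))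
        (m := z * (Polynomial.aeval z (Polynomial.C q * Polynomial.X ^ n) * s)) (by
      refine h1.congr_fun fun m => ?_
      rw [PowerSeries.coeff_succ_X_mul]
      ring)
    have hs : Polynomial.aeval z (Polynomial.C q * Polynomial.X ^ (n + 1)) * s =
        z ^ 0 * ((PowerSeries.coeff 0 (PowerSeries.X *
          (((Polynomial.C q * Polynomial.X ^ n : Polynomial ℚ) : PowerSeries ℚ) * a)) : ℚ) : ℂ) +
        z * (Polynomial.aeval z (Polynomial.C q * Polynomial.X ^ n) * s) := by
      simp
      ring
    rw [hs]
    exact h2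

theorem hasFPowerSeriesAt_oneSubTwoPow (r : ℚ) :
    HasFPowerSeriesAt (fun t : ℂ => (1 - 2 * t) ^ (r : ℂ))
      (FormalMultilinearSeries.ofScalars ℂ
        fun n => ((PowerSeries.coeff n (oneSubTwoPow r) : ℚ) : ℂ)) 0 := by
  have h := hasFPowerSeriesAt_iff.1 (Complex.one_add_cpow_hasFPowerSeriesAt_zero (a := (r : ℂ)))
  rw [hasFPowerSeriesAt_iff]
  have ht : Filter.Tendsto (fun z : ℂ => -2 * z) (nhds 0) (nhds 0) := by
    have : Continuous fun z : ℂ => -2 * z := by fun_prop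
    simpa using this.tendsto 0
  -- The expansion of `(1 + w)^r` is evaluated at `w = -2z`, which stays near `0`.
  filter_upwards [ht.eventually h] with z hz
  simp only [zero_add] at hz ⊢
  rw [show (1 : ℂ) - 2 * z = 1 + -2 * z by ring]
  convert hz using 2 with n
  rw [FormalMultilinearSeries.coeff_ofScalars, binomialSeries,
    FormalMultilinearSeries.coeff_ofScalars, coeff_oneSubTwoPow]
  have := Ring.map_choose (Rat.castHom ℂ) r n
  simp only [Rat.coe_castHom] at this
  rw [← this]
  simp only [smul_eq_mul]
  push_cast
  ring

theorem hasFPowerSeriesAt_of_eq_mul {f : PowerSeries ℚ} {p : Polynomial ℚ} {D : ℕ}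
    (h : f = (p : PowerSeries ℚ) * oneSubTwoPow (-(3 / 2 + (D : ℚ)))) :
    HasFPowerSeriesAt
      (fun t : ℂ => Polynomial.aeval t p / (1 - 2 * t) ^ (3 / 2 + (D : ℂ)))
      (FormalMultilinearSeries.ofScalars ℂ
        fun n => ((PowerSeries.coeff n f : ℚ) : ℂ)) 0 := by
  have h1 := hasFPowerSeriesAt_iff.1 (hasFPowerSeriesAt_oneSubTwoPow (-(3 / 2 + (D : ℚ))))
  rw [hasFPowerSeriesAt_iff]
  filter_upwards [h1] with z hz
  simp only [FormalMultilinearSeries.coeff_ofScalars, smul_eq_mul, zero_add] at hz ⊢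
  rw [h, div_eq_mul_inv ((Polynomial.aeval z) p), ← Complex.cpow_neg]
  push_cast at hz
  exact hasSum_polynomial_mul hz p

/-! ### Coefficients of the Borel transform -/

theorem coeff_borelC (x n : ℕ) :
    PowerSeries.coeff n (borelC x) =
      (if Even x then (c (n + x ⌈/⌉ 2 + 1) (2 * (n + x ⌈/⌉ 2 + 1) - x) : ℚ)
        else (c (n + x ⌈/⌉ 2) (2 * (n + x ⌈/⌉ 2) - x) : ℚ)) / (n ! : ℚ) := by
  rw [borelC, borel, PowerSeries.coeff_mk, PowerSeries.coeff_map, genC, PowerSeries.coeff_mk]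
  split_ifs <;> simp

theorem coeff_borelC_even (α n : ℕ) :
    PowerSeries.coeff n (borelC (2 * α)) = (c (n + 1 + α) (2 * n + 2) : ℚ) / (n ! : ℚ) := by
  have h : (2 * α) ⌈/⌉ 2 = α := by rw [Nat.ceilDiv_eq_add_pred_div]; omega
  rw [coeff_borelC, if_pos (even_two_mul α), h, show n + α + 1 = n + 1 + α by ring,
    show 2 * (n + 1 + α) - 2 * α = 2 * n + 2 by omega]

theorem coeff_borelC_odd {α : ℕ} (hα : 1 ≤ α) (n : ℕ) :
    PowerSeries.coeff n (borelC (2 * α - 1)) = (c (n + α) (2 * n + 1) : ℚ) / (n ! : ℚ) := by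
  have h : (2 * α - 1) ⌈/⌉ 2 = α := by rw [Nat.ceilDiv_eq_add_pred_div]; omega
  have ho : ¬ Even (2 * α - 1) := by
    rw [Nat.not_even_iff_odd]
    exact ⟨α - 1, by omega⟩
  rw [coeff_borelC, if_neg ho, h, show 2 * (n + α) - (2 * α - 1) = 2 * n + 1 by omega]

theorem degBound_even (α : ℕ) : degBound (2 * α) = 3 * α := by
  rw [degBound, Nat.ceilDiv_eq_add_pred_div]; omega

theorem degBound_odd {α : ℕ} (hα : 1 ≤ α) : degBound (2 * α - 1) = 3 * α - 2 := by
  rw [degBound, Nat.ceilDiv_eq_add_pred_div]; omega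

theorem factorial_two_mul_add_one (n : ℕ) :
    ((2 * n + 1)! : ℚ) = ((2 * n + 1)‼ : ℚ) * (2 ^ n * (n ! : ℚ)) := by
  rw [Nat.factorial_eq_mul_doubleFactorial, Nat.doubleFactorial_two_mul]
  push_cast
  ring

theorem factorial_two_mul_add_two (n : ℕ) :
    ((2 * n + 2)! : ℚ) = ((2 * n + 1)‼ : ℚ) * (2 ^ (n + 1) * ((n + 1)! : ℚ)) := by
  rw [Nat.factorial_eq_mul_doubleFactorial, show 2 * n + 1 + 1 = 2 * (n + 1) by ring,
    Nat.doubleFactorial_two_mul]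
  push_cast
  ring

/-- The normalized number of partitions without isolated edges in an odd number of variables. -/
noncomputable def aOdd (α j : ℕ) : ℚ := 2 ^ j * (cIso (2 * j + 1) (j + α) 0 : ℚ) / ((2 * j + 1)! : ℚ)

/-- The normalized number of partitions without isolated edges in an even number of variables. -/
noncomputable def aEven (α j : ℕ) : ℚ :=
  2 ^ (j + 1) * (cIso (2 * j + 2) (j + 1 + α) 0 : ℚ) / ((2 * j + 2)! : ℚ)

/-- The bound reads `2(2j+1) ≤ 3(j+α)`, that is `j ≤ 3α - 2`; this is the source of the degree. -/
theorem aOdd_eq_zero {α j : ℕ} (h : 3 * α - 2 < j) : aOdd α j = 0 := by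
  have : cIso (2 * j + 1) (j + α) 0 = 0 := by
    by_contra hne
    have := two_mul_le_of_cIso_zero_ne hne
    omega
  simp [aOdd, this]

theorem aEven_eq_zero {α j : ℕ} (h : 3 * α ≤ j) : aEven α j = 0 := by
  have : cIso (2 * j + 2) (j + 1 + α) 0 = 0 := by
    by_contra hne
    have := two_mul_le_of_cIso_zero_ne hne
    omega
  simp [aEven, this]

theorem c_odd_eq (α n : ℕ) :
    (c (n + α) (2 * n + 1) : ℚ) / (((2 * n + 1)‼ : ℚ) * (n ! : ℚ)) =
      ∑ j ∈ range (n + 1), aOdd α j / ((n - j)! : ℚ) := by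
  rw [c_succ_eq_card_thick, card_thick n 1 α le_rfl, sum_div]
  refine sum_congr rfl fun j hj => ?_
  have hj : j ≤ n := by simpa [Nat.lt_succ_iff] using hj
  obtain ⟨m, rfl⟩ := Nat.exists_eq_add_of_le hj
  have : ((2 * (j + m) + 1)‼ : ℚ) ≠ 0 := by positivity
  rw [aOdd, factorial_two_mul_add_one (j + m), show j + m - j = m by omega, pow_add]
  field_simp

theorem c_even_eq {α : ℕ} (hα : 1 ≤ α) (n : ℕ) :
    (c (n + 1 + α) (2 * n + 2) : ℚ) / (((2 * n + 1)‼ : ℚ) * ((n + 1)! : ℚ)) =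
      ∑ j ∈ range (n + 1), aEven α j / ((n - j)! : ℚ) := by
  have h0 : cIso (2 * 0 + 0) (0 + α) 0 = 0 := by
    obtain ⟨β, rfl⟩ := Nat.exists_eq_add_of_le' hα
    simpa using cIso_zero_succ β
  have hc := card_thick (n + 1) 0 α zero_le_one
  -- The term with no variables left vanishes since `α ≥ 1`; dropping it shifts the index by one.
  rw [sum_range_succ', h0, Nat.cast_zero, zero_mul, add_zero (Finset.sum _ _)] at hc
  rw [c_succ_eq_card_thick]
  change ((thick (2 * n + 2) (n + 1 + α)).card : ℚ) = _ at hc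
  rw [hc, sum_div]
  refine sum_congr rfl fun j hj => ?_
  have hj : j ≤ n := by simpa [Nat.lt_succ_iff] using hj
  obtain ⟨m, rfl⟩ := Nat.exists_eq_add_of_le hj
  have : ((2 * (j + m) + 1)‼ : ℚ) ≠ 0 := by positivity
  rw [aEven, show 2 * (j + m + 1) + 0 = 2 * (j + m) + 2 by ring, factorial_two_mul_add_two (j + m),
    show j + m + 1 - (j + 1) = m by omega, show j + m - j = m by omega,
    show 2 * (j + 1) + 0 = 2 * j + 2 by ring, show j + m + 1 = j + 1 + m by ring, pow_add 2 (j + 1) m]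
  field_simp

/-- For `α = 0` the bound would force `4(j+1) ≤ 3(j+1)`, so only the empty graph remains after
deleting isolated edges: these are the perfect matchings. -/
theorem c_matching (n : ℕ) : (c (n + 1) (2 * n + 2) : ℚ) = ((2 * n + 1)‼ : ℚ) := by
  have hc := card_thick (n + 1) 0 0 zero_le_one
  rw [sum_range_succ', sum_eq_zero] at hc
  · rw [c_succ_eq_card_thick]
    change ((thick (2 * n + 2) (n + 1)).card : ℚ) = _ at hc
    rw [hc, show 2 * (n + 1) + 0 = 2 * n + 2 by ring, factorial_two_mul_add_two n,
      show cIso (2 * 0 + 0) (0 + 0) 0 = 1 from cIso_zero_zero]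
    simp
    field_simp
  · intro j _
    have : cIso (2 * (j + 1) + 0) (j + 1 + 0) 0 = 0 := by
      by_contra hne
      have := two_mul_le_of_cIso_zero_ne hne
      omega
    rw [this]
    simp

/-! ### The numerators -/

/-- The numerator of the Borel transform for odd `x = 2α - 1`. -/
noncomputable def polyOdd (α : ℕ) : Polynomial ℚ :=
  ∑ j ∈ range (3 * α - 2 + 1), Polynomial.C (aOdd α j) * basisPoly (3 * α - 2) j

/-- The numerator of the Borel transform for even `x = 2α > 0`. -/
noncomputable def polyEven (α : ℕ) : Polynomial ℚ :=
  ∑ j ∈ range (3 * α), Polynomial.C (aEven α j) *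
    (basisPoly (3 * α) (j + 1) + Polynomial.C ((j : ℚ) + 1) * basisPoly (3 * α) j)

theorem natDegree_polyOdd_le (α : ℕ) : (polyOdd α).natDegree ≤ 3 * α - 2 := by
  refine Polynomial.natDegree_sum_le_of_forall_le _ _ fun j hj => ?_
  exact (Polynomial.natDegree_C_mul_le _ _).trans
    (natDegree_basisPoly_le (Nat.lt_succ_iff.1 (mem_range.1 hj)))

theorem natDegree_polyEven_le (α : ℕ) : (polyEven α).natDegree ≤ 3 * α := by
  refine Polynomial.natDegree_sum_le_of_forall_le _ _ fun j hj => ?_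
  have hj := mem_range.1 hj
  refine (Polynomial.natDegree_C_mul_le _ _).trans (Polynomial.natDegree_add_le_of_degree_le
    (natDegree_basisPoly_le (by omega)) ?_)
  exact (Polynomial.natDegree_C_mul_le _ _).trans (natDegree_basisPoly_le hj.le)

/-- Trades a range depending on `n` for a fixed one, as the numerator must not depend on `n`. -/
theorem sum_range_eq_sum_ite {f : ℕ → ℚ} {M : ℕ} (hf : ∀ j, M ≤ j → f j = 0) (n : ℕ) :
    ∑ j ∈ range (n + 1), f j = ∑ j ∈ range M, if j ≤ n then f j else 0 := by
  have h1 : ∑ j ∈ range (n + 1), f j =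
      ∑ j ∈ range (n + 1 + M), if j ≤ n then f j else 0 := by
    rw [← sum_filter]
    congr 1
    ext j
    simp only [mem_range, mem_filter]
    omega
  rw [h1]
  symm
  refine sum_subset (range_mono (by omega)) fun j _ hj => ?_
  rw [hf j (by simpa using hj), ite_self]

theorem borelC_odd {α : ℕ} (hα : 1 ≤ α) :
    borelC (2 * α - 1) = (polyOdd α : PowerSeries ℚ) *
      oneSubTwoPow (-(3 / 2 + ((3 * α - 2 : ℕ) : ℚ))) := by
  ext n
  have hsum : (polyOdd α : PowerSeries ℚ) =
      ∑ j ∈ range (3 * α - 2 + 1), PowerSeries.C (aOdd α j) *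
        (basisPoly (3 * α - 2) j : PowerSeries ℚ) := by
    rw [polyOdd, ← Polynomial.coeToPowerSeries.ringHom_apply, map_sum]
    simp
  have hc := c_odd_eq α n
  rw [div_eq_iff (by positivity)] at hc
  rw [coeff_borelC_odd hα, hsum, sum_mul, map_sum, hc,
    sum_range_eq_sum_ite (M := 3 * α - 2 + 1) fun j hj => by
      rw [aOdd_eq_zero (by omega), zero_div], sum_mul, sum_div]
  refine sum_congr rfl fun j hj => ?_
  rw [mul_assoc, PowerSeries.coeff_C_mul,
    coeff_basisPoly_mul (Nat.lt_succ_iff.1 (mem_range.1 hj))]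
  split_ifs
  · field_simp
  · simp

/-- Here the factor `(n+1)!/n! = n+1` survives. Writing it as `(n-j) + (j+1)` gives `(n+1)/(n-j)! =
1/(n-j-1)! + (j+1)/(n-j)!`, whence the two basis polynomials; the first term is absent for `j = n`.
-/
theorem borelC_even {α : ℕ} (hα : 1 ≤ α) :
    borelC (2 * α) = (polyEven α : PowerSeries ℚ) *
      oneSubTwoPow (-(3 / 2 + ((3 * α : ℕ) : ℚ))) := by
  ext n
  have hsum : (polyEven α : PowerSeries ℚ) =
      ∑ j ∈ range (3 * α), PowerSeries.C (aEven α j) *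
        ((basisPoly (3 * α) (j + 1) : PowerSeries ℚ) +
          PowerSeries.C ((j : ℚ) + 1) * (basisPoly (3 * α) j : PowerSeries ℚ)) := by
    rw [polyEven, ← Polynomial.coeToPowerSeries.ringHom_apply, map_sum]
    refine sum_congr rfl fun j _ => ?_
    rw [Polynomial.coeToPowerSeries.ringHom_apply, Polynomial.coe_mul, Polynomial.coe_add,
      Polynomial.coe_mul, Polynomial.coe_C, Polynomial.coe_C]
  have hc := c_even_eq hα n
  rw [div_eq_iff (by positivity)] at hc
  rw [coeff_borelC_even, hsum, sum_mul, map_sum, hc,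
    sum_range_eq_sum_ite (M := 3 * α) fun j hj => by
      rw [aEven_eq_zero hj, zero_div], sum_mul, sum_div]
  refine sum_congr rfl fun j hj => ?_
  have hj := mem_range.1 hj
  rw [mul_assoc, PowerSeries.coeff_C_mul, add_mul, map_add, mul_assoc, PowerSeries.coeff_C_mul,
    coeff_basisPoly_mul (by omega), coeff_basisPoly_mul hj.le, Nat.factorial_succ]
  rcases lt_trichotomy j n with h | rfl | h
  · obtain ⟨m, rfl⟩ := Nat.exists_eq_add_of_le h
    rw [if_pos h.le, if_pos (by omega), if_pos h.le,
      show j.succ + m - (j + 1) = m by omega, show j.succ + m - j = m + 1 by omega,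
      Nat.factorial_succ m]
    push_cast
    field_simp
    ring
  · rw [if_pos le_rfl, if_neg (by omega), if_pos le_rfl]
    push_cast
    field_simp
    simp
    ring
  · rw [if_neg (by omega), if_neg (by omega), if_neg (by omega)]
    simp

theorem borelC_zero : borelC 0 = oneSubTwoPow (-(3 / 2 + ((0 : ℕ) : ℚ))) := by
  ext n
  have h := coeff_basisPoly_mul (le_refl 0) n
  have h1 : basisPoly 0 0 = 1 := by simp [basisPoly]
  rw [h1, Polynomial.coe_one, one_mul] at h
  rw [h, if_pos (Nat.zero_le n), Nat.sub_zero, ← c_matching]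
  exact coeff_borelC_even 0 n

/-! ### The coefficients of the numerators -/

theorem coeff_polyOdd {α h : ℕ} (hh : h ≤ 3 * α - 2) : (polyOdd α).coeff h = muOdd α h := by
  have ha := binomial_inversion (c_odd_eq α)
  have h1 : (polyOdd α).coeff h = ∑ y ∈ range (h + 1),
      aOdd α y * (((2 * y + 1)‼ : ℚ) * (((3 * α - 2 - y).choose (h - y) : ℚ) * (-2) ^ (h - y))) := by
    rw [polyOdd, Polynomial.finsetSum_coeff]
    simp only [Polynomial.coeff_C_mul, coeff_basisPoly, mul_ite, mul_zero]
    rw [← sum_filter]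
    refine sum_congr ?_ fun _ _ => rfl
    ext j
    simp only [mem_filter, mem_range]
    omega
  rw [h1, muOdd, ← Nat.range_succ_eq_Icc_zero]
  simp_rw [mul_sum]
  rw [sum_sigma']
  simp_rw [ha, sum_mul]
  rw [sum_sigma']
  refine sum_bij' (fun p _ => ⟨p.2, p.1⟩) (fun p _ => ⟨p.2, p.1⟩) ?_ ?_ (fun _ _ => rfl)
    (fun _ _ => rfl) ?_
  · rintro ⟨y, z⟩ hp
    simp only [mem_sigma, mem_range, mem_Icc] at hp ⊢
    omega
  · rintro ⟨z, y⟩ hp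
    simp only [mem_sigma, mem_range, mem_Icc] at hp ⊢
    omega
  · rintro ⟨y, z⟩ hp
    simp only [mem_sigma, mem_range] at hp
    have hzy : z ≤ y := by omega
    have hyh : y ≤ h := by omega
    obtain ⟨u, rfl⟩ := Nat.exists_eq_add_of_le hzy
    obtain ⟨v, rfl⟩ := Nat.exists_eq_add_of_le hyh
    simp only [show z + u - z = u by omega, show z + u + v - (z + u) = v by omega]
    -- With `u = y - z` and `v = h - y`, the signs from the inversion and from `(-2)^(h-y)` combine
    -- to `(-1)^(z+h)`.
    have hs : (-1 : ℚ) ^ z * (-1) ^ (z + u + v) = (-1) ^ u * (-1) ^ v := by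
      rw [pow_add, pow_add, ← mul_assoc, ← mul_assoc, ← mul_pow]; simp
    rw [show (-2 : ℚ) = -1 * 2 by norm_num, mul_pow]
    field_simp
    linear_combination -(c (z + α) (2 * z + 1) : ℚ) * ((3 * α - 2 - (z + u)).choose v : ℚ) * hs

/-- The identity `binom(D-y-1, h-y-1) = (h-y)/(D-y) · binom(D-y, h-y)` merges the two terms, and the
bracket is `2y + 2 - (2y+3)(h-y)/(D-y)` rewritten. -/
theorem coeff_basisPoly_succ_add {D y h : ℕ} (hy : y < D) (hh : h ≤ D) :
    (basisPoly D (y + 1)).coeff h + ((y : ℚ) + 1) * (basisPoly D y).coeff h =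
      if y ≤ h then ((2 * y + 1)‼ : ℚ) * ((-2) ^ (h - y) / 2 * (((D - y).choose (h - y) : ℚ) *
        ((2 * (y : ℚ) + 3) * ((D : ℚ) - h) / ((D : ℚ) - y) - 1))) else 0 := by
  rw [coeff_basisPoly, coeff_basisPoly]
  obtain ⟨N, rfl⟩ := Nat.exists_eq_add_of_lt hy
  have hN : (N : ℚ) + 1 ≠ 0 := by positivity
  have hD : ((y + N + 1 : ℕ) : ℚ) - y = N + 1 := by push_cast; ring
  rw [show 2 * (y + 1) + 1 = 2 * y + 1 + 2 by ring, Nat.doubleFactorial_add_two,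
    show y + N + 1 - (y + 1) = N by omega, show y + N + 1 - y = N + 1 by omega, hD]
  rcases lt_trichotomy y h with hlt | rfl | hlt
  · obtain ⟨m, rfl⟩ := Nat.exists_eq_add_of_le hlt
    have hm : m ≤ N := by omega
    rw [if_pos (by omega), if_pos (by omega), if_pos (by omega),
      show y.succ + m - (y + 1) = m by omega, show y.succ + m - y = m + 1 by omega]
    have hch : ((N + 1 : ℕ) : ℚ) * (N.choose m : ℚ) = ((N + 1).choose (m + 1) : ℚ) * (m + 1 : ℕ) := by
      exact_mod_cast Nat.add_one_mul_choose_eq N m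
    rw [pow_succ]
    push_cast at hch ⊢
    field_simp
    linear_combination ((2 * (y : ℚ) + 3)) * hch
  · rw [if_neg (by omega), if_pos le_rfl, if_pos le_rfl, hD]
    simp
    field_simp
    ring
  · rw [if_neg (by omega), if_neg (by omega), if_neg (by omega)]
    simp

theorem coeff_polyEven {α h : ℕ} (hα : 1 ≤ α) (hh : h ≤ 3 * α) :
    (polyEven α).coeff h = muEven α h := by
  have ha := binomial_inversion (c_even_eq hα)
  have h1 : (polyEven α).coeff h = ∑ y ∈ (range (3 * α)).filter fun y => y ≤ h,
      aEven α y * (((2 * y + 1)‼ : ℚ) * ((-2) ^ (h - y) / 2 *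
        (((3 * α - y).choose (h - y) : ℚ) *
          ((2 * (y : ℚ) + 3) * (3 * (α : ℚ) - h) / (3 * (α : ℚ) - y) - 1)))) := by
    rw [polyEven, Polynomial.finsetSum_coeff, sum_filter]
    refine sum_congr rfl fun y hy => ?_
    rw [Polynomial.coeff_C_mul, Polynomial.coeff_add, Polynomial.coeff_C_mul,
      coeff_basisPoly_succ_add (mem_range.1 hy) hh, mul_ite, mul_zero]
    push_cast
    rfl
  rw [h1, muEven]
  simp_rw [ite_mul, zero_mul, ← sum_filter, mul_sum]
  rw [sum_sigma']
  simp_rw [ha, sum_mul]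
  rw [sum_sigma']
  refine sum_bij' (fun p _ => ⟨p.2, p.1⟩) (fun p _ => ⟨p.2, p.1⟩) ?_ ?_ (fun _ _ => rfl)
    (fun _ _ => rfl) ?_
  · rintro ⟨y, z⟩ hp
    simp only [mem_sigma, mem_filter, mem_range, mem_Icc] at hp ⊢
    omega
  · rintro ⟨z, y⟩ hp
    simp only [mem_sigma, mem_filter, mem_range, mem_Icc] at hp ⊢
    omega
  · rintro ⟨y, z⟩ hp
    simp only [mem_sigma, mem_filter, mem_range] at hp
    have hzy : z ≤ y := by omega
    have hyh : y ≤ h := by omega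
    dsimp only
    generalize (2 * (y : ℚ) + 3) * (3 * (α : ℚ) - h) / (3 * (α : ℚ) - y) - 1 = Q
    generalize ((3 * α - y).choose (h - y) : ℚ) = B
    obtain ⟨u, rfl⟩ := Nat.exists_eq_add_of_le hzy
    obtain ⟨v, rfl⟩ := Nat.exists_eq_add_of_le hyh
    simp only [show z + u - z = u by omega, show z + u + v - (z + u) = v by omega]
    have hs : (-1 : ℚ) ^ (z + (z + u + v)) = (-1) ^ u * (-1) ^ v := by
      rw [pow_add, pow_add, pow_add, ← mul_assoc, ← mul_assoc, ← mul_pow]; simp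
    -- The `(z+1)!` normalising the counts and the `1/(y-z)!` of the inversion form `binom(y+1,
    -- z+1)`, once `(y+1)!` is supplied by `(2y+2)‼ = 2^(y+1) (y+1)!`.
    have hch : ((z + u + 1).choose (z + 1) : ℚ) * ((z + 1)! : ℚ) * (u ! : ℚ) =
        ((z + u + 1)! : ℚ) := by
      have := Nat.choose_mul_factorial_mul_factorial (show z + 1 ≤ z + u + 1 by omega)
      rw [show z + u + 1 - (z + 1) = u by omega] at this
      exact_mod_cast this
    have hch' : ((z + u + 1).choose (z + 1) : ℚ) =
        ((z + u + 1)! : ℚ) / (((z + 1)! : ℚ) * (u ! : ℚ)) := by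
      rw [eq_div_iff (by positivity), ← hch]; ring
    rw [show 2 * (z + u) + 2 = 2 * (z + u + 1) by ring, Nat.doubleFactorial_two_mul, hs, hch',
      show (-2 : ℚ) = -1 * 2 by norm_num, mul_pow]
    push_cast
    rw [pow_add 2 (z + u) v, pow_succ]
    field_simp

end HigherPartition

theorem theorem3p6 (x : ℕ) :
    ∃ p : Polynomial ℚ,
      -- `p` is the polynomial `c_x(t)`
      p.natDegree ≤ HigherPartition.degBound x ∧
      -- the identity of formal power series
      HigherPartition.borelC x =
        (p : PowerSeries ℚ) *
          HigherPartition.oneSubTwoPow (-(3 / 2 + (HigherPartition.degBound x : ℚ))) ∧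
      -- the Borel transform is the Taylor series at `0` of the corresponding analytic function
      HasFPowerSeriesAt
        (fun t : ℂ => Polynomial.aeval t p /
          (1 - 2 * t) ^ (3 / 2 + (HigherPartition.degBound x : ℂ)))
        (FormalMultilinearSeries.ofScalars ℂ
          fun n => ((PowerSeries.coeff n (HigherPartition.borelC x) : ℚ) : ℂ)) 0 ∧
      -- the coefficients
      (x = 0 → p = 1) ∧
      (∀ α : ℕ, 1 ≤ α → x = 2 * α →
        ∀ h ≤ 3 * α, p.coeff h = HigherPartition.muEven α h) ∧
      (∀ α : ℕ, 1 ≤ α → x = 2 * α - 1 →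
        ∀ h ≤ 3 * α - 2, p.coeff h = HigherPartition.muOdd α h) := by
  obtain rfl | ⟨β, hβ, rfl⟩ | ⟨β, hβ, rfl⟩ :
      x = 0 ∨ (∃ β, 1 ≤ β ∧ x = 2 * β) ∨ ∃ β, 1 ≤ β ∧ x = 2 * β - 1 := by
    rcases Nat.even_or_odd' x with ⟨β, h | h⟩
    · rcases Nat.eq_zero_or_pos β with h0 | h0
      · left; omega
      · exact Or.inr (Or.inl ⟨β, h0, h⟩)
    · exact Or.inr (Or.inr ⟨β + 1, by omega, by omega⟩)
  · have hD : HigherPartition.degBound 0 = 0 := HigherPartition.degBound_even 0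
    have heq : HigherPartition.borelC 0 = ((1 : Polynomial ℚ) : PowerSeries ℚ) *
        HigherPartition.oneSubTwoPow (-(3 / 2 + (HigherPartition.degBound 0 : ℚ))) := by
      rw [hD, Polynomial.coe_one, one_mul, HigherPartition.borelC_zero]
    refine ⟨1, by simp, heq, HigherPartition.hasFPowerSeriesAt_of_eq_mul heq, fun _ => rfl, ?_, ?_⟩
    · intro α hα h0; omega
    · intro α hα h0; omega
  · have hD := HigherPartition.degBound_even β
    have heq : HigherPartition.borelC (2 * β) = (HigherPartition.polyEven β : PowerSeries ℚ) *
        HigherPartition.oneSubTwoPow (-(3 / 2 + (HigherPartition.degBound (2 * β) : ℚ))) := by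
      rw [hD, HigherPartition.borelC_even hβ]
    refine ⟨HigherPartition.polyEven β, hD ▸ HigherPartition.natDegree_polyEven_le β, heq,
      HigherPartition.hasFPowerSeriesAt_of_eq_mul heq, fun h => by omega, ?_, ?_⟩
    · intro α hα h0 h hh
      obtain rfl : α = β := by omega
      exact HigherPartition.coeff_polyEven hα hh
    · intro α hα h0; omega
  · have hD := HigherPartition.degBound_odd hβ
    have heq : HigherPartition.borelC (2 * β - 1) = (HigherPartition.polyOdd β : PowerSeries ℚ) *
        HigherPartition.oneSubTwoPow (-(3 / 2 + (HigherPartition.degBound (2 * β - 1) : ℚ))) := by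
      rw [hD, HigherPartition.borelC_odd hβ]
    refine ⟨HigherPartition.polyOdd β, hD ▸ HigherPartition.natDegree_polyOdd_le β, heq,
      HigherPartition.hasFPowerSeriesAt_of_eq_mul heq, fun h => by omega, ?_, ?_⟩
    · intro α hα h0; omega
    · intro α hα h0 h hh
      obtain rfl : α = β := by omega
      exact HigherPartition.coeff_polyOdd hh
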